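/- Let $\mathcal C$ be the ring of germs at $+\infty$ of continuous functions $[a,+\infty)\to\mathbb R$ ($a\in\mathbb R$), let $\mathcal C^r$ be its subring of germs of $r$ times continuously differentiable functions $[a,+\infty)\to\mathbb R$ ($a\in\mathbb R$), and let $\mathcal C^{<\infty}=\bigcap_{r\in\mathbb N}\mathcal C^r$, a differential ring with the obvious derivation. For $g,h\in\mathcal C$ write $g<_{\mathrm e}h$ (or $h>_{\mathrm e}g$) if $g(t)<h(t)$ for all sufficiently large $t$; for $H\subseteq\mathcal C$, write $y>_{\mathrm e}H$ if $y>_{\mathrm e}h$ for all $h\in H$. A Hardy field is a subring of $\mathcal C^{<\infty}$ that is a field and is closed under the derivation. Real numbers are identified with germs of constant functions. A Hardy field $H$ is Liouville closed if it is real closed and for every $f\in H$ there are $g\in H$ with $g'=f$ and $z\in H\setminus\{0\}$ with $z'/z=f$. A germ $y\in\mathcal C$ is hardian if $y\in\mathcal C^{<\infty}$ and $y$ generates a Hardy field $\mathbb Q\langle y\rangle$ (that is, there is a smallest Hardy field containing $y$). Given a Hardy field $H$, it is $H$-hardian if it lies in some Hardy field extension of $H$. For $y\in\mathcal C^{<\infty}$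 put $y^{\langle 0\rangle}=y$ and, as long as $y^{\langle i\rangle}$ is defined and a unit of $\mathcal C^{<\infty}$, $y^{\langle i+1\rangle}=(y^{\langle i\rangle})'/y^{\langle i\rangle}$; otherwise $y^{\langle i+1\rangle}$ is undefined. The germ $y$ is overhardian if $y\in\mathcal C^{<\infty}$ and for all $i\in\mathbb N$, $y^{\langle i\rangle}$ is defined, $y^{\langle i\rangle}>_{\mathrm e}0$, and $y^{\langle i\rangle}>_{\mathrm e}y^{\langle i+1\rangle}$. Let $x$ be the germ of the identity function, $\exp_0(x)=x$ and $\exp_{n+1}(x)=\exp(\exp_n(x))$. 1. Let $H\supseteq\mathbb R$ be a Liouville closed Hardy field and let $y\in\mathcal C$ satisfy $y>_{\mathrm e}H$. Then the following are equivalent: (i) $y$ is overhardian; (ii) $y$ is $H$-hardian; (iii) $y$ is hardian. 2. If $y$ is overhardian, then so is $\log y$. Moreover, a germ $y\in\mathcal C$ is overhardian if and only if $y$ is hardian and $y>_{\mathrm e}\exp_n(x)$ for all $n\in\mathbb N$. -/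

import Mathlib

open Filter

namespace HardyGerm

/-- Germs at `+∞` of real-valued functions of a real variable. It is a commutative ring under the
pointwise operations; all the germs of interest lie in the subring `contGerms`. -/
abbrev RGerm : Type := Germ (atTop : Filter ℝ) ℝ

/-- `𝒞^r`: the germs of `r` times continuously differentiable functions `[a, +∞) → ℝ`, `a ∈ ℝ`. -/
def ckGerms (r : ℕ) : Set RGerm :=
  {y | ∃ (a : ℝ) (f : ℝ → ℝ), ContDiffOn ℝ r f (Set.Ici a) ∧ y = (f : RGerm)}

/-- `𝒞`: the germs of continuous functions `[a, +∞) → ℝ`, `a ∈ ℝ`. -/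
def contGerms : Set RGerm :=
  {y | ∃ (a : ℝ) (f : ℝ → ℝ), ContinuousOn f (Set.Ici a) ∧ y = (f : RGerm)}

/-- `𝒞^{<∞}`: the intersection of all the `𝒞^r`, `r ∈ ℕ`. -/
def smoothGerms : Set RGerm := {y | ∀ r : ℕ, y ∈ ckGerms r}

/-- Functions that agree near `+∞` have derivatives that agree near `+∞`. -/
theorem eventuallyEq_deriv {f g : ℝ → ℝ} (h : f =ᶠ[atTop] g) : deriv f =ᶠ[atTop] deriv g := by
  obtain ⟨a, ha⟩ := eventually_atTop.1 h
  filter_upwards [eventually_gt_atTop a] with t ht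
  apply EventuallyEq.deriv_eq
  filter_upwards [Ioi_mem_nhds ht] with s hs
  exact ha s (le_of_lt hs)

/-- The derivation on germs: the germ of `f` is sent to the germ of `f'`. It is used on `𝒞^{<∞}`. -/
noncomputable def der (y : RGerm) : RGerm :=
  Germ.map' deriv (fun _ _ h => eventuallyEq_deriv h) y

/-- `g <ₑ h`: `g(t) < h(t)` for all sufficiently large `t`. -/
def LtE (g h : RGerm) : Prop := Germ.LiftRel (· < ·) g h

/-- A Hardy field: a subring of `𝒞^{<∞}` that is a field and is closed under the derivation. -/
structure IsHardyField (H : Subring RGerm) : Prop where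
  subset_smooth : ∀ y ∈ H, y ∈ smoothGerms
  isField : IsField H
  der_mem : ∀ y ∈ H, der y ∈ H

/-- `ℝ ⊆ H`, where real numbers are identified with the germs of constant functions. -/
def ContainsReals (H : Subring RGerm) : Prop := ∀ c : ℝ, (Germ.const c : RGerm) ∈ H

/-- A Hardy field is Liouville closed if it is real closed, every element has an
antiderivative in it, and every element is the logarithmic derivative `z'/z` of some nonzero `z`
in it. -/
structure IsLiouvilleClosedHardyField (H : Subring RGerm) : Prop where
  isHardyField : IsHardyField H
  isRealClosed : @IsRealClosed H isHardyField.isField.toField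
  exists_integral : ∀ f ∈ H, ∃ g ∈ H, der g = f
  exists_exp_integral : ∀ f ∈ H, ∃ z ∈ H, z ≠ 0 ∧ der z = f * z

/-- `y` is `H`-hardian: `y` is contained in a Hardy field extension of `H`. -/
def IsHardianOver (H : Subring RGerm) (y : RGerm) : Prop :=
  ∃ F : Subring RGerm, IsHardyField F ∧ H ≤ F ∧ y ∈ F

/-- `y` is hardian: `y ∈ 𝒞^{<∞}` and `y` generates a Hardy field `ℚ⟨y⟩`, that is, there is
a smallest Hardy field that contains `y`. -/
def IsHardian (y : RGerm) : Prop :=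
  y ∈ smoothGerms ∧ ∃ F : Subring RGerm, IsLeast {F | IsHardyField F ∧ y ∈ F} F

/-- `y` is a unit of the ring `𝒞^{<∞}`. -/
def IsSmoothUnit (y : RGerm) : Prop := y ∈ smoothGerms ∧ ∃ z ∈ smoothGerms, y * z = 1

/-- The logarithmic derivative `y† = y'/y`, for `y` a unit of `𝒞^{<∞}`. -/
noncomputable def logDer (y : RGerm) : RGerm := der y / y

/-- `y^⟨i⟩`: `y^⟨0⟩ = y` and `y^⟨i+1⟩ = (y^⟨i⟩)†`; meaningful if `LogDerDefined y i`. -/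
noncomputable def iterLogDer (y : RGerm) : ℕ → RGerm
  | 0 => y
  | i + 1 => logDer (iterLogDer y i)

/-- `y^⟨i⟩` is defined (for `y ∈ 𝒞^{<∞}`): all the previous `y^⟨j⟩` are units of `𝒞^{<∞}`. -/
def LogDerDefined (y : RGerm) : ℕ → Prop
  | 0 => y ∈ smoothGerms
  | i + 1 => LogDerDefined y i ∧ IsSmoothUnit (iterLogDer y i)

/-- `y` is overhardian: `y ∈ 𝒞^{<∞}` and for all `i`, `y^⟨i⟩` is defined, `y^⟨i⟩ >ₑ 0` and
`y^⟨i⟩ >ₑ y^⟨i+1⟩`. -/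
def IsOverhardian (y : RGerm) : Prop :=
  y ∈ smoothGerms ∧ ∀ i : ℕ, LogDerDefined y i ∧ LtE 0 (iterLogDer y i) ∧
    LtE (iterLogDer y (i + 1)) (iterLogDer y i)

/-- The germ `log y` of `t ↦ log (y t)`, for `y >ₑ 0`. -/
noncomputable def logGerm (y : RGerm) : RGerm := Germ.map Real.log y

/-- The germ `exp_n(x)`: `exp_0(x) = x` is the germ of the identity, and
`exp_{n+1}(x) = exp(exp_n(x))`. -/
noncomputable def expIter (n : ℕ) : RGerm := ((Real.exp^[n] : ℝ → ℝ) : RGerm)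

end HardyGerm

/-!
Let `y` be overhardian and `z i = y^⟨i⟩`. Since `(z i)' = z i * z (i + 1) > 0`, each `z i` is
bounded below by a positive constant, and so tends to `+∞` because `(log (z i))' = z (i + 1)`.
Comparing derivatives further, every power of `z (i + 1)` is negligible against `z i`, and `z i`
exceeds `exp (z (i + 2))`, hence all the `exp_n`. If a Hardy field `H` lies below all the `z i`,
then the monomials in the `z i`, ordered lexicographically, form a scale that is coarser than `H`:
a nonzero polynomial in the `z i` over `H` is dominated by its leading term, so is eventually
nonzero. The fractions of such polynomials therefore form a Hardy field, and `y` is `H`-hardian.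
It is enough that `H` lies below `y` if `H` is cofinally closed under exponentiation, because
`z (i + 1)` is eventually increasing and hence `log (z i) ≤ x * z (i + 1) + O(1)`.

Conversely, let `y > exp_n` for all `n` be in a Hardy field. Every element of a Hardy field is
eventually monotone, so `y† = (log y)'` either is bounded above, which contradicts `log y > exp x`,
or satisfies `log y ≤ x * y† + O(1)`, and then `y† > exp_n` for all `n` as well; moreover `y† < y`,
since `y ^ 2 ≤ y'` would make `-1/y` exceed `x + O(1)`. Iterating, `y` is overhardian. If `y` is
overhardian, then `log y` is an antiderivative of the element `y†` of a Hardy field, so by Rolle's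
theorem and induction on the degree its polynomials over that field are zero or eventually
nonzero. Hence `log y` is in a Hardy field too, and it again exceeds all the `exp_n`.
-/

namespace HardyGerm

section Growth

variable {f f' f'' g g' : ℝ → ℝ}

theorem exists_monotoneOn_Ici_of_deriv_nonneg (hf : ∀ᶠ t in atTop, HasDerivAt f (f' t) t)
    (h : ∀ᶠ t in atTop, 0 ≤ f' t) : ∃ a, MonotoneOn f (Set.Ici a) := by
  obtain ⟨a, ha⟩ := eventually_atTop.1 (hf.and h)
  exact ⟨a, monotoneOn_of_hasDerivWithinAt_nonneg (convex_Ici a)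
    (fun t ht => (ha t ht).1.continuousAt.continuousWithinAt)
    (fun t ht => (ha t (interior_subset ht)).1.hasDerivWithinAt)
    fun t ht => (ha t (interior_subset ht)).2⟩

theorem exists_gt_eventually_le_of_deriv_nonneg (hf : ∀ᶠ t in atTop, HasDerivAt f (f' t) t)
    (h : ∀ᶠ t in atTop, 0 ≤ f' t) {c : ℝ} (hc : ∃ᶠ t in atTop, c < f t) :
    ∃ b > c, ∀ᶠ t in atTop, b ≤ f t := by
  obtain ⟨a, ha⟩ := exists_monotoneOn_Ici_of_deriv_nonneg hf h
  obtain ⟨s, hs, has⟩ := (hc.and_eventually (eventually_ge_atTop a)).exists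
  exact ⟨f s, hs, (eventually_ge_atTop s).mono fun t ht => ha has (has.trans ht) ht⟩

theorem exists_eventually_le_add_of_deriv_le (hf : ∀ᶠ t in atTop, HasDerivAt f (f' t) t)
    (hg : ∀ᶠ t in atTop, HasDerivAt g (g' t) t) (h : ∀ᶠ t in atTop, f' t ≤ g' t) :
    ∃ C, ∀ᶠ t in atTop, f t ≤ g t + C := by
  obtain ⟨a, ha⟩ := exists_monotoneOn_Ici_of_deriv_nonneg (hg.and hf |>.mono fun _ h => h.1.sub h.2)
    (h.mono fun _ => sub_nonneg.2)
  refine ⟨f a - g a, (eventually_ge_atTop a).mono fun t ht => ?_⟩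
  have hmono : g a - f a ≤ g t - f t := ha Set.self_mem_Ici ht ht
  linarith

theorem tendsto_atTop_of_le_deriv (hf : ∀ᶠ t in atTop, HasDerivAt f (f' t) t) {c : ℝ} (hc : 0 < c)
    (h : ∀ᶠ t in atTop, c ≤ f' t) : Tendsto f atTop atTop := by
  obtain ⟨C, hC⟩ := exists_eventually_le_add_of_deriv_le
    (.of_forall fun t => by simpa using (hasDerivAt_id t).const_mul c) hf h
  refine tendsto_atTop_mono' _ (hC.mono fun t ht => sub_le_iff_le_add.2 ht) ?_
  exact tendsto_atTop_add_const_right _ (-C) (tendsto_id.const_mul_atTop hc)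

theorem exists_eventually_le_mul_deriv_add (hf : ∀ᶠ t in atTop, HasDerivAt f (f' t) t)
    (hf' : ∀ᶠ t in atTop, HasDerivAt f' (f'' t) t) (h : ∀ᶠ t in atTop, 0 ≤ f'' t) :
    ∃ C, ∀ᶠ t in atTop, f t ≤ t * f' t + C := by
  refine exists_eventually_le_add_of_deriv_le hf
    (hf'.mono fun t ht => (hasDerivAt_id t).mul ht) ?_
  filter_upwards [h, eventually_ge_atTop 0] with t h₀ ht
  simpa using mul_nonneg ht h₀

/- Otherwise `-1/f` has derivative at least `1` and is negative. -/
theorem not_eventually_sq_le_deriv (hf : ∀ᶠ t in atTop, HasDerivAt f (f' t) t)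
    (hpos : ∀ᶠ t in atTop, 0 < f t) : ¬ ∀ᶠ t in atTop, f t ^ 2 ≤ f' t := by
  intro h
  have hd : ∀ᶠ t in atTop, HasDerivAt (fun s => -(f s)⁻¹) (f' t / f t ^ 2) t := by
    filter_upwards [hf, hpos] with t ht h₀
    simpa [neg_div] using (ht.fun_inv h₀.ne').fun_neg
  have htendsto := tendsto_atTop_of_le_deriv hd one_pos <| by
    filter_upwards [h, hpos] with t ht h₀ using (one_le_div (by positivity)).2 ht
  obtain ⟨t, ht, h₀⟩ := ((htendsto.eventually_gt_atTop 0).and hpos).exists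
  exact (neg_pos.1 ht).not_gt (inv_pos.2 h₀)

theorem eventually_pos_or_eventually_neg (hf : ∀ᶠ t in atTop, ContinuousAt f t)
    (h : ∀ᶠ t in atTop, f t ≠ 0) : (∀ᶠ t in atTop, 0 < f t) ∨ ∀ᶠ t in atTop, f t < 0 := by
  obtain ⟨a, ha⟩ := eventually_atTop.1 (hf.and h)
  by_contra! ⟨hpos, hneg⟩
  obtain ⟨s, hs, has⟩ := (hpos.and_eventually (eventually_ge_atTop a)).exists
  obtain ⟨t, ht, hat⟩ := (hneg.and_eventually (eventually_ge_atTop a)).exists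
  obtain ⟨u, hu, hu₀⟩ := isPreconnected_Ici.intermediate_value has hat
    (fun v hv => (ha v hv).1.continuousWithinAt) ⟨hs, ht⟩
  exact (ha u hu).2 hu₀

end Growth

section SmoothGerms

variable {f g : ℝ → ℝ} {a b : RGerm}

theorem exists_coe_eq (a : RGerm) : ∃ f : ℝ → ℝ, (f : RGerm) = a := a.exists_rep

theorem coe_mem_smoothGerms :
    (f : RGerm) ∈ smoothGerms ↔ ∀ r : ℕ, ∀ᶠ t in atTop, ContDiffAt ℝ r f t := by
  refine forall_congr' fun r => ⟨?_, fun h => ?_⟩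
  · rintro ⟨a, g, hg, hfg⟩
    obtain ⟨b, hb⟩ := eventually_atTop.1 (Germ.coe_eq.1 hfg)
    filter_upwards [eventually_gt_atTop a, eventually_gt_atTop b] with t hat hbt
    exact (hg.contDiffAt (Ici_mem_nhds hat)).congr_of_eventuallyEq
      (mem_of_superset (Ioi_mem_nhds hbt) fun s hs => hb s hs.le)
  · obtain ⟨a, ha⟩ := eventually_atTop.1 h
    exact ⟨a, f, fun t ht => (ha t ht).contDiffWithinAt, rfl⟩

theorem eventually_hasDerivAt (hf : (f : RGerm) ∈ smoothGerms) :
    ∀ᶠ t in atTop, HasDerivAt f (deriv f t) t :=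
  (coe_mem_smoothGerms.1 hf 1).mono fun _ ht => (ht.differentiableAt (by simp)).hasDerivAt

theorem der_coe_eq_coe_iff (hf : (f : RGerm) ∈ smoothGerms) :
    der (f : RGerm) = g ↔ ∀ᶠ t in atTop, HasDerivAt f (g t) t := by
  refine Germ.coe_eq.trans ⟨fun h => ?_, fun h => h.mono fun t ht => ht.deriv⟩
  filter_upwards [h, eventually_hasDerivAt hf] with t ht hft using ht ▸ hft

theorem ltE_coe : LtE (f : RGerm) g ↔ ∀ᶠ t in atTop, f t < g t := Iff.rfl

theorem isUnit_coe : IsUnit (f : RGerm) ↔ ∀ᶠ t in atTop, f t ≠ 0 := by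
  refine isUnit_iff_exists_inv.trans ⟨?_, fun h => ⟨(f : RGerm)⁻¹, Germ.coe_eq.2 ?_⟩⟩
  · rintro ⟨⟨g⟩, hfg⟩
    exact (Germ.coe_eq.1 hfg).mono fun t ht => left_ne_zero_of_mul_eq_one ht
  · exact h.mono fun t ht => mul_inv_cancel₀ ht

/-- `𝒞^{<∞}` as a subring of the ring of germs; `der` is a derivation on it. -/
def smoothRing : Subring RGerm where
  carrier := smoothGerms
  mul_mem' := by
    rintro ⟨f⟩ ⟨g⟩ hf hg
    refine coe_mem_smoothGerms.2 fun r => ?_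
    filter_upwards [coe_mem_smoothGerms.1 hf r, coe_mem_smoothGerms.1 hg r] with t h₁ h₂
    exact h₁.mul h₂
  one_mem' := coe_mem_smoothGerms.2 fun _ => .of_forall fun _ => contDiffAt_const
  add_mem' := by
    rintro ⟨f⟩ ⟨g⟩ hf hg
    refine coe_mem_smoothGerms.2 fun r => ?_
    filter_upwards [coe_mem_smoothGerms.1 hf r, coe_mem_smoothGerms.1 hg r] with t h₁ h₂
    exact h₁.add h₂
  zero_mem' := coe_mem_smoothGerms.2 fun _ => .of_forall fun _ => contDiffAt_const
  neg_mem' := by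
    rintro ⟨f⟩ hf
    exact coe_mem_smoothGerms.2 fun r => (coe_mem_smoothGerms.1 hf r).mono fun t ht => ht.neg

theorem der_mem_smoothGerms (ha : a ∈ smoothGerms) : der a ∈ smoothGerms := by
  obtain ⟨f, rfl⟩ := exists_coe_eq a
  refine coe_mem_smoothGerms.2 fun r => ?_
  filter_upwards [coe_mem_smoothGerms.1 ha (r + 1)] with t ht
  exact (ht.fderiv_right (m := r) (by norm_cast)).clm_apply contDiffAt_const

theorem der_add (ha : a ∈ smoothGerms) (hb : b ∈ smoothGerms) : der (a + b) = der a + der b := by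
  obtain ⟨f, rfl⟩ := exists_coe_eq a
  obtain ⟨g, rfl⟩ := exists_coe_eq b
  refine (der_coe_eq_coe_iff (smoothRing.add_mem ha hb)).2 ?_
  filter_upwards [eventually_hasDerivAt ha, eventually_hasDerivAt hb] with t h₁ h₂ using h₁.add h₂

theorem der_mul (ha : a ∈ smoothGerms) (hb : b ∈ smoothGerms) :
    der (a * b) = der a * b + a * der b := by
  obtain ⟨f, rfl⟩ := exists_coe_eq a
  obtain ⟨g, rfl⟩ := exists_coe_eq b
  refine (der_coe_eq_coe_iff (smoothRing.mul_mem ha hb)).2 ?_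
  filter_upwards [eventually_hasDerivAt ha, eventually_hasDerivAt hb] with t h₁ h₂ using h₁.mul h₂

theorem der_const (c : ℝ) : der (Germ.const c) = 0 :=
  Germ.coe_eq.2 (.of_forall fun t => deriv_const t c)

/-- The derivation `der` restricted to a subring of `𝒞^{<∞}` that is closed under it, as a structure
of differential ring in the sense of the library. -/
noncomputable abbrev differential {R : Subring RGerm} (hR : R ≤ smoothRing)
    (hder : ∀ a ∈ R, der a ∈ R) : Differential R where
  deriv := Derivation.mk'
    (AddMonoidHom.mk' (fun a => ⟨der a, hder a a.2⟩)
      fun a b => Subtype.ext (der_add (hR a.2) (hR b.2))).toIntLinearMap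
    fun a b => Subtype.ext <| by
      change der (a * b : RGerm) = a * der b + b * der a
      rw [der_mul (hR a.2) (hR b.2)]
      ring

noncomputable instance : Differential smoothRing := differential le_rfl fun _ => der_mem_smoothGerms

theorem inv_mem_smoothGerms (ha : a ∈ smoothGerms) (hu : IsUnit a) : a⁻¹ ∈ smoothGerms := by
  obtain ⟨f, rfl⟩ := exists_coe_eq a
  refine coe_mem_smoothGerms.2 fun r => ?_
  filter_upwards [coe_mem_smoothGerms.1 ha r, isUnit_coe.1 hu] with t ht h₀ using ht.inv h₀

theorem exists_eq_const_of_der_eq_zero (ha : a ∈ smoothGerms) (h : der a = 0) :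
    ∃ c : ℝ, a = Germ.const c := by
  obtain ⟨f, rfl⟩ := exists_coe_eq a
  obtain ⟨b, hb⟩ := eventually_atTop.1 ((der_coe_eq_coe_iff ha).1 h)
  refine ⟨f b, Germ.coe_eq.2 ((eventually_ge_atTop b).mono fun t ht => ?_)⟩
  exact constant_of_has_deriv_right_zero
    (fun s hs => (hb s hs.1).continuousAt.continuousWithinAt)
    (fun s hs => (hb s hs.1).hasDerivWithinAt) t ⟨ht, le_rfl⟩

/- By Rolle's theorem, `a` has at most one zero where its derivative does not vanish. -/
theorem isUnit_of_isUnit_der (ha : a ∈ smoothGerms) (h : IsUnit (der a)) : IsUnit a := by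
  obtain ⟨f, rfl⟩ := exists_coe_eq a
  obtain ⟨b, hb⟩ := eventually_atTop.1 ((eventually_hasDerivAt ha).and (isUnit_coe.1 h))
  refine isUnit_coe.2 ?_
  by_contra! hfreq
  obtain ⟨s, hs, hbs⟩ := (hfreq.and_eventually (eventually_ge_atTop b)).exists
  obtain ⟨t, ht, hst⟩ := (hfreq.and_eventually (eventually_gt_atTop s)).exists
  obtain ⟨u, hu, hu₀⟩ := exists_hasDerivAt_eq_zero hst
    (fun v hv => (hb v (hbs.trans hv.1)).1.continuousAt.continuousWithinAt) (by simp_all)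
    fun v hv => (hb v (hbs.trans hv.1.le)).1
  exact (hb u (hbs.trans hu.1.le)).2 hu₀

theorem eq_zero_or_isUnit_of_der (ha : a ∈ smoothGerms) (h : der a = 0 ∨ IsUnit (der a)) :
    a = 0 ∨ IsUnit a := by
  refine h.elim (fun h => ?_) fun h => .inr (isUnit_of_isUnit_der ha h)
  obtain ⟨c, rfl⟩ := exists_eq_const_of_der_eq_zero ha h
  rcases eq_or_ne c 0 with rfl | hc
  exacts [.inl rfl, .inr (isUnit_coe.2 (.of_forall fun _ => hc))]

end SmoothGerms

section HardyFields

variable {H R : Subring RGerm} {a b y : RGerm}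

theorem isField_iff : IsField R ↔ ∀ a ∈ R, a ≠ 0 → IsUnit a ∧ a⁻¹ ∈ R := by
  refine ⟨fun h a ha h₀ => ?_, fun h => ⟨⟨0, 1, zero_ne_one⟩, mul_comm, fun {a} h₀ => ?_⟩⟩
  · obtain ⟨b, hb⟩ := h.mul_inv_cancel (a := ⟨a, ha⟩) (Subtype.coe_ne_coe.1 h₀)
    have hab : a * b = 1 := congrArg Subtype.val hb
    exact ⟨.of_mul_eq_one _ hab, inv_eq_of_mul_eq_one_right hab ▸ b.2⟩
  · obtain ⟨hu, hinv⟩ := h a a.2 (Subtype.coe_ne_coe.2 h₀)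
    exact ⟨⟨_, hinv⟩, Subtype.ext hu.mul_inv_cancel⟩

theorem IsHardyField.isUnit (hH : IsHardyField H) (ha : a ∈ H) (h₀ : a ≠ 0) : IsUnit a :=
  (isField_iff.1 hH.isField a ha h₀).1

theorem IsHardyField.inv_mem (hH : IsHardyField H) (ha : a ∈ H) (h₀ : a ≠ 0) : a⁻¹ ∈ H :=
  (isField_iff.1 hH.isField a ha h₀).2

theorem IsHardyField.logDer_mem (hH : IsHardyField H) (ha : a ∈ H) (h₀ : a ≠ 0) : logDer a ∈ H := by
  rw [logDer, div_eq_mul_inv]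
  exact H.mul_mem (hH.der_mem a ha) (hH.inv_mem ha h₀)

theorem isHardyField_sInf {𝓕 : Set (Subring RGerm)} (hne : 𝓕.Nonempty)
    (h : ∀ F ∈ 𝓕, IsHardyField F) : IsHardyField (sInf 𝓕) := by
  obtain ⟨F, hF⟩ := hne
  have hle : sInf 𝓕 ≤ F := sInf_le hF
  refine ⟨fun a ha => (h F hF).subset_smooth a (hle ha), isField_iff.2 fun a ha h₀ => ?_, ?_⟩
  · exact ⟨(h F hF).isUnit (hle ha) h₀,
      Subring.mem_sInf.2 fun K hK => (h K hK).inv_mem (Subring.mem_sInf.1 ha K hK) h₀⟩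
  · exact fun a ha => Subring.mem_sInf.2 fun K hK =>
      (h K hK).der_mem a (Subring.mem_sInf.1 ha K hK)

theorem IsHardyField.isHardian (hH : IsHardyField H) (hy : y ∈ H) : IsHardian y :=
  ⟨hH.subset_smooth y hy, sInf {F | IsHardyField F ∧ y ∈ F},
    ⟨isHardyField_sInf ⟨H, hH, hy⟩ fun _ hF => hF.1, Subring.mem_sInf.2 fun _ hF => hF.2⟩,
    fun _ hF => sInf_le hF⟩

theorem IsHardyField.ltE_trichotomy (hH : IsHardyField H) (ha : a ∈ H) (hb : b ∈ H) :
    LtE a b ∨ a = b ∨ LtE b a := by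
  rcases eq_or_ne a b with hab | hab
  · exact .inr (.inl hab)
  have hmem := H.sub_mem ha hb
  have hunit := hH.isUnit hmem (sub_ne_zero.2 hab)
  obtain ⟨f, rfl⟩ := exists_coe_eq a
  obtain ⟨g, rfl⟩ := exists_coe_eq b
  have hcont := (eventually_hasDerivAt (f := f - g) (hH.subset_smooth _ hmem)).mono fun _ ht =>
    ht.continuousAt
  rcases eventually_pos_or_eventually_neg hcont (isUnit_coe.1 hunit) with h | h
  · exact .inr (.inr (h.mono fun t ht => sub_pos.1 ht))
  · exact .inl (h.mono fun t ht => sub_neg.1 ht)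

/-- The ring of fractions of `R` inside the ring of germs: the germs `a / b` with `a` and `b` in `R`
and `b` invertible as a germ. -/
def fractions (R : Subring RGerm) : Subring RGerm where
  carrier := {f | ∃ a ∈ R, ∃ b ∈ R, IsUnit b ∧ f * b = a}
  mul_mem' := by
    rintro f g ⟨_, ha, b, hb, hbu, rfl⟩ ⟨_, hc, d, hd, hdu, rfl⟩
    exact ⟨_, R.mul_mem ha hc, _, R.mul_mem hb hd, hbu.mul hdu, mul_mul_mul_comm ..⟩
  one_mem' := ⟨1, R.one_mem, 1, R.one_mem, isUnit_one, one_mul 1⟩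
  add_mem' := by
    rintro f g ⟨_, ha, b, hb, hbu, rfl⟩ ⟨_, hc, d, hd, hdu, rfl⟩
    exact ⟨_, R.add_mem (R.mul_mem ha hd) (R.mul_mem hc hb), _, R.mul_mem hb hd, hbu.mul hdu,
      by ring⟩
  zero_mem' := ⟨0, R.zero_mem, 1, R.one_mem, isUnit_one, zero_mul 1⟩
  neg_mem' := by
    rintro f ⟨_, ha, b, hb, hbu, rfl⟩
    exact ⟨_, R.neg_mem ha, b, hb, hbu, neg_mul ..⟩

theorem le_fractions (R : Subring RGerm) : R ≤ fractions R := fun a ha =>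
  ⟨a, ha, 1, R.one_mem, isUnit_one, mul_one a⟩

theorem fractions_le_smoothRing (hR : R ≤ smoothRing) : fractions R ≤ smoothRing := by
  rintro f ⟨_, ha, b, hb, hbu, rfl⟩
  simpa [mul_assoc, hbu.mul_inv_cancel] using
    smoothRing.mul_mem (hR ha) (inv_mem_smoothGerms (hR hb) hbu)

theorem isHardyField_fractions (hR : R ≤ smoothRing) (hder : ∀ a ∈ R, der a ∈ R)
    (hunit : ∀ a ∈ R, a ≠ 0 → IsUnit a) : IsHardyField (fractions R) where
  subset_smooth _ := @fractions_le_smoothRing R hR _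
  isField := isField_iff.2 <| by
    rintro f ⟨_, ha, b, hb, hbu, rfl⟩ h₀
    have hfbu : IsUnit (f * b) := hunit _ ha (hbu.mul_left_eq_zero.not.2 h₀)
    have hfu := isUnit_of_mul_isUnit_left hfbu
    exact ⟨hfu, b, hb, f * b, ha, hfbu, by rw [← mul_assoc, hfu.inv_mul_cancel, one_mul]⟩
  der_mem f hf := by
    obtain ⟨_, ha, b, hb, hbu, rfl⟩ := id hf
    have hquot : der f * (b * b) = der (f * b) * b - f * b * der b := by
      rw [der_mul (fractions_le_smoothRing hR hf) (hR hb)]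
      ring
    exact ⟨_, R.sub_mem (R.mul_mem (hder _ ha) hb) (R.mul_mem ha (hder b hb)), _, R.mul_mem hb hb,
      hbu.mul hbu, hquot⟩

theorem IsHardyField.exists_adjoin (hH : IsHardyField H) {S : Set RGerm} (hS : S ⊆ smoothGerms)
    (hder : ∀ s ∈ S, der s ∈ Algebra.adjoin H S)
    (hunit : ∀ a ∈ Algebra.adjoin H S, a ≠ 0 → IsUnit a) :
    ∃ K, IsHardyField K ∧ H ≤ K ∧ S ⊆ K := by
  have hsmooth : ∀ a ∈ Algebra.adjoin H S, a ∈ smoothGerms := fun a ha => by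
    induction ha using Algebra.adjoin_induction with
    | mem a ha => exact hS ha
    | algebraMap a => exact hH.subset_smooth a a.2
    | add a b _ _ ha hb => exact smoothRing.add_mem ha hb
    | mul a b _ _ ha hb => exact smoothRing.mul_mem ha hb
  refine ⟨_, isHardyField_fractions (R := (Algebra.adjoin H S).toSubring) hsmooth ?_ hunit,
    fun a ha => le_fractions _ ((Algebra.adjoin H S).algebraMap_mem ⟨a, ha⟩),
    fun s hs => le_fractions _ (Algebra.subset_adjoin hs)⟩
  intro a ha
  induction ha using Algebra.adjoin_induction with
  | mem a ha => exact hder a ha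
  | algebraMap a => exact (Algebra.adjoin H S).algebraMap_mem ⟨_, hH.der_mem a a.2⟩
  | add a b ha hb ha' hb' =>
    rw [der_add (hsmooth a ha) (hsmooth b hb)]
    exact add_mem ha' hb'
  | mul a b ha hb ha' hb' =>
    rw [der_mul (hsmooth a ha) (hsmooth b hb)]
    exact add_mem (mul_mem ha' hb) (mul_mem ha hb')

end HardyFields

section Antiderivatives

open Polynomial
open scoped Differential

theorem natDegree_implicitDeriv_C_lt {K : Type*} [CommRing K] [Differential K] (c : K) {p : K[X]}
    (hp : p.Monic) (h₀ : p.natDegree ≠ 0) :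
    (Differential.implicitDeriv (C c) p).natDegree < p.natDegree := by
  have hmap : (Differential.mapCoeffs p).natDegree < p.natDegree := by
    refine Nat.lt_of_le_pred (Nat.pos_of_ne_zero h₀) (natDegree_le_iff_coeff_eq_zero.2 ?_)
    intro m hm
    rcases (Nat.le_of_pred_lt hm).eq_or_lt with rfl | hm
    · rw [Differential.coeff_mapCoeffs, hp.coeff_natDegree, Derivation.map_one_eq_zero]
    · rw [Differential.coeff_mapCoeffs, coeff_eq_zero_of_natDegree_lt hm, map_zero]
  have hderiv : (C c * derivative p).natDegree < p.natDegree :=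
    (natDegree_C_mul_le _ _).trans_lt (natDegree_derivative_lt h₀)
  exact (natDegree_add_le _ _).trans_lt (max_lt hmap hderiv)

/- The derivative of `p(w)` for a monic `p` is `q(w)` with `q` of smaller degree. -/
theorem aeval_eq_zero_or_isUnit_of_deriv_eq_algebraMap {K A : Type*} [Field K] [Differential K]
    [CommRing A] [Differential A] [Algebra K A] [DifferentialAlgebra K A]
    (hA : ∀ a : A, a′ = 0 ∨ IsUnit a′ → a = 0 ∨ IsUnit a) {w : A} {c : K}
    (hw : w′ = algebraMap K A c) (p : K[X]) : aeval w p = 0 ∨ IsUnit (aeval w p) := by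
  induction hn : p.natDegree using Nat.strong_induction_on generalizing p with
  | _ n ih => ?_
  have hmonic : ∀ q : K[X], q.Monic → q.natDegree = n → aeval w q = 0 ∨ IsUnit (aeval w q) := by
    rintro q hq rfl
    rcases eq_or_ne q.natDegree 0 with h₀ | h₀
    · simp [hq.natDegree_eq_zero.1 h₀]
    · refine hA _ ?_
      rw [Differential.deriv_aeval_eq_implicitDeriv w (C c) (by rw [hw, aeval_C])]
      exact ih _ (natDegree_implicitDeriv_C_lt c hq h₀) _ rfl
  rcases eq_or_ne p 0 with rfl | hp
  · simp
  have hlc : IsUnit (aeval w (C p.leadingCoeff)) :=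
    ((leadingCoeff_ne_zero.2 hp).isUnit.map C).map (aeval w)
  have hp_eq : p = C p.leadingCoeff * (p * C p.leadingCoeff⁻¹) := by
    rw [mul_left_comm, ← C_mul, mul_inv_cancel₀ (leadingCoeff_ne_zero.2 hp), C_1, mul_one]
  rw [hp_eq, map_mul]
  refine (hmonic _ (monic_mul_leadingCoeff_inv hp) ?_).imp (fun h => ?_) hlc.mul
  · rw [natDegree_mul_leadingCoeff_inv p hp, hn]
  · rw [h, mul_zero]

theorem isUnit_smoothRing {a : smoothRing} : IsUnit a ↔ IsUnit (a : RGerm) :=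
  ⟨fun h => h.map smoothRing.subtype, fun h =>
    .of_mul_eq_one ⟨_, inv_mem_smoothGerms a.2 h⟩ (Subtype.ext h.mul_inv_cancel)⟩

theorem eq_zero_or_isUnit_of_deriv (a : smoothRing) (h : a′ = 0 ∨ IsUnit a′) :
    a = 0 ∨ IsUnit a := by
  rw [Subtype.ext_iff, isUnit_smoothRing] at h ⊢
  exact eq_zero_or_isUnit_of_der a.2 h

variable {H : Subring RGerm} {w : RGerm}

theorem IsHardyField.aeval_eq_zero_or_isUnit (hH : IsHardyField H) (hw : w ∈ smoothGerms)
    (hder : der w ∈ H) (p : H[X]) : aeval w p = 0 ∨ IsUnit (aeval w p) := by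
  let _ : Field H := hH.isField.toField
  let _ : Differential H := differential hH.subset_smooth hH.der_mem
  let _ : Algebra H smoothRing := (Subring.inclusion hH.subset_smooth).toAlgebra
  have : DifferentialAlgebra H smoothRing := ⟨fun _ => rfl⟩
  have : IsScalarTower H smoothRing RGerm := .of_algebraMap_eq fun _ => rfl
  have h := aeval_eq_zero_or_isUnit_of_deriv_eq_algebraMap (c := (⟨_, hder⟩ : H))
    eq_zero_or_isUnit_of_deriv (w := ⟨w, hw⟩) rfl p
  rw [Subtype.ext_iff, isUnit_smoothRing] at h
  rwa [show w = algebraMap smoothRing RGerm ⟨w, hw⟩ from rfl, aeval_algebraMap_apply]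

theorem IsHardyField.isHardianOver_of_der_mem (hH : IsHardyField H) (hw : w ∈ smoothGerms)
    (hder : der w ∈ H) : IsHardianOver H w := by
  have hunit : ∀ a ∈ Algebra.adjoin H {w}, a ≠ 0 → IsUnit a := by
    intro a ha h₀
    rw [Algebra.adjoin_singleton_eq_range_aeval] at ha
    obtain ⟨p, rfl⟩ := ha
    exact (hH.aeval_eq_zero_or_isUnit hw hder p).resolve_left h₀
  obtain ⟨K, hK, hHK, hwK⟩ := hH.exists_adjoin (Set.singleton_subset_iff.2 hw)
    (fun s hs => hs ▸ (Algebra.adjoin H {w}).algebraMap_mem ⟨_, hder⟩) hunit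
  exact ⟨K, hK, hHK, hwK rfl⟩

end Antiderivatives

section LogDerChains

theorem der_eq_mul_logDer {a : RGerm} (ha : IsUnit a) : der a = a * logDer a := by
  rw [logDer, div_eq_mul_inv, mul_left_comm, ha.mul_inv_cancel, mul_one]

/-- A sequence of functions representing the iterated logarithmic derivatives `y^⟨i⟩` of an
overhardian germ `y`: near `+∞` they are positive and decreasing in `i`, and `z (i + 1)` is the
logarithmic derivative of `z i`. -/
structure LogDerChain (z : ℕ → ℝ → ℝ) : Prop where
  pos : ∀ i, ∀ᶠ t in atTop, 0 < z i t
  lt : ∀ i, ∀ᶠ t in atTop, z (i + 1) t < z i t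
  hasDerivAt : ∀ i, ∀ᶠ t in atTop, HasDerivAt (z i) (z i t * z (i + 1) t) t

theorem IsOverhardian.isSmoothUnit {y : RGerm} (hy : IsOverhardian y) (i : ℕ) :
    IsSmoothUnit (iterLogDer y i) :=
  (hy.2 (i + 1)).1.2

theorem IsOverhardian.isUnit {y : RGerm} (hy : IsOverhardian y) (i : ℕ) :
    IsUnit (iterLogDer y i) :=
  let ⟨_, _, h⟩ := (hy.isSmoothUnit i).2
  .of_mul_eq_one _ h

theorem IsOverhardian.exists_logDerChain {y : RGerm} (hy : IsOverhardian y) :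
    ∃ z, LogDerChain z ∧ ∀ i, (z i : RGerm) = iterLogDer y i := by
  choose z hz using fun i => exists_coe_eq (iterLogDer y i)
  refine ⟨z, ⟨fun i => ltE_coe.1 ?_, fun i => ltE_coe.1 ?_, fun i => ?_⟩, hz⟩
  · exact (hz i).symm ▸ (hy.2 i).2.1
  · exact (hz i).symm ▸ (hz (i + 1)).symm ▸ (hy.2 i).2.2
  · refine (der_coe_eq_coe_iff ((hz i).symm ▸ (hy.isSmoothUnit i).1)).1 ?_
    calc der (z i) = iterLogDer y i * iterLogDer y (i + 1) :=
          (congrArg der (hz i)).trans (der_eq_mul_logDer (hy.isUnit i))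
      _ = z i * z (i + 1) := by rw [hz, hz]

namespace LogDerChain

open Asymptotics

variable {z : ℕ → ℝ → ℝ}

theorem exists_pos_le (hz : LogDerChain z) (i : ℕ) : ∃ c > 0, ∀ᶠ t in atTop, c ≤ z i t := by
  refine exists_gt_eventually_le_of_deriv_nonneg (hz.hasDerivAt i) ?_ (hz.pos i).frequently
  filter_upwards [hz.pos i, hz.pos (i + 1)] with t h₀ h₁ using (mul_pos h₀ h₁).le

theorem hasDerivAt_log (hz : LogDerChain z) (i : ℕ) :
    ∀ᶠ t in atTop, HasDerivAt (fun s => Real.log (z i s)) (z (i + 1) t) t := by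
  filter_upwards [hz.hasDerivAt i, hz.pos i] with t ht h₀
  simpa [h₀.ne'] using ht.log h₀.ne'

theorem tendsto_atTop (hz : LogDerChain z) (i : ℕ) : Tendsto (z i) atTop atTop := by
  obtain ⟨c, hc, hcz⟩ := hz.exists_pos_le (i + 1)
  refine tendsto_atTop_mono' _ ?_ (tendsto_atTop_of_le_deriv (hz.hasDerivAt_log i) hc hcz)
  filter_upwards [hz.pos i] with t h₀ using Real.log_le_self h₀.le

theorem hasDerivAt_div (hz : LogDerChain z) (i : ℕ) : ∀ᶠ t in atTop,
    HasDerivAt (fun s => z i s / z (i + 1) s) (z i t / z (i + 1) t * (z (i + 1) t - z (i + 2) t))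
      t := by
  filter_upwards [hz.hasDerivAt i, hz.hasDerivAt (i + 1), hz.pos (i + 1)] with t h₀ h₁ hpos
  refine (h₀.fun_div h₁ hpos.ne').congr_deriv ?_
  field_simp

theorem exists_one_lt_le_div (hz : LogDerChain z) (i : ℕ) :
    ∃ K > 1, ∀ᶠ t in atTop, K ≤ z i t / z (i + 1) t := by
  refine exists_gt_eventually_le_of_deriv_nonneg (hz.hasDerivAt_div i) ?_ ?_
  · filter_upwards [hz.pos i, hz.pos (i + 1), hz.lt (i + 1)] with t h₀ h₁ hlt
    exact mul_nonneg (div_nonneg h₀.le h₁.le) (sub_nonneg.2 hlt.le)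
  · refine Eventually.frequently ?_
    filter_upwards [hz.pos (i + 1), hz.lt i] with t h₁ hlt using (one_lt_div h₁).2 hlt

theorem tendsto_div (hz : LogDerChain z) (i : ℕ) :
    Tendsto (fun t => z i t / z (i + 1) t) atTop atTop := by
  obtain ⟨c, hc, hcz⟩ := hz.exists_pos_le (i + 1)
  obtain ⟨K, hK, hKz⟩ := hz.exists_one_lt_le_div (i + 1)
  refine tendsto_atTop_of_le_deriv (hz.hasDerivAt_div i)
    (mul_pos hc (sub_pos.2 (inv_lt_one_of_one_lt₀ hK))) ?_
  filter_upwards [hcz, hKz, hz.pos (i + 1), hz.pos (i + 2), hz.lt i] with t hct hKt h₁ h₂ hlt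
  have hle : z (i + 2) t ≤ z (i + 1) t * K⁻¹ := by
    rw [le_div_iff₀ h₂] at hKt
    field_simp
    linarith
  calc c * (1 - K⁻¹) ≤ z (i + 1) t * (1 - K⁻¹) :=
        mul_le_mul_of_nonneg_right hct (sub_pos.2 (inv_lt_one_of_one_lt₀ hK)).le
    _ ≤ z (i + 1) t - z (i + 2) t := by linarith
    _ ≤ z i t / z (i + 1) t * (z (i + 1) t - z (i + 2) t) := by
        refine le_mul_of_one_le_left ?_ ((one_le_div h₁).2 hlt.le)
        nlinarith [inv_lt_one_of_one_lt₀ hK]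

theorem tendsto_log_sub_mul_log (hz : LogDerChain z) (i n : ℕ) :
    Tendsto (fun t => Real.log (z i t) - n * Real.log (z (i + 1) t)) atTop atTop := by
  obtain ⟨c, hc, hcz⟩ := hz.exists_pos_le (i + 2)
  have hderiv : ∀ᶠ t in atTop, HasDerivAt (fun s => Real.log (z i s) - n * Real.log (z (i + 1) s))
      (z (i + 1) t - n * z (i + 2) t) t := by
    filter_upwards [hz.hasDerivAt_log i, hz.hasDerivAt_log (i + 1)] with t h₀ h₁
    exact h₀.sub (h₁.const_mul _)
  refine tendsto_atTop_of_le_deriv hderiv hc ?_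
  filter_upwards [hcz, (hz.tendsto_div (i + 1)).eventually_ge_atTop (n + 1), hz.pos (i + 2)]
    with t hct hdiv h₂
  rw [le_div_iff₀ h₂] at hdiv
  linarith

theorem pow_isLittleO (hz : LogDerChain z) (i n : ℕ) : (z (i + 1) ^ n) =o[atTop] z i := by
  refine (isLittleO_iff_tendsto' ?_).2 ?_
  · filter_upwards [hz.pos i] with t h₀ h using absurd h h₀.ne'
  · refine (Real.tendsto_exp_neg_atTop_nhds_zero.comp (hz.tendsto_log_sub_mul_log i n)).congr' ?_
    filter_upwards [hz.pos i, hz.pos (i + 1)] with t h₀ h₁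
    simp [Real.exp_sub, Real.exp_log h₀, Real.exp_log h₁, Real.exp_nat_mul]

/- `z (i + 2)` has derivative at most `z (i + 2) ^ 2 =o z (i + 1)`, and `log (z i)` has derivative
`z (i + 1)`. -/
theorem exp_lt (hz : LogDerChain z) (i : ℕ) : ∀ᶠ t in atTop, Real.exp (z (i + 2) t) < z i t := by
  have hderiv : ∀ᶠ t in atTop, 2 * (z (i + 2) t * z (i + 3) t) ≤ z (i + 1) t := by
    filter_upwards [(hz.pow_isLittleO (i + 1) 2).bound one_half_pos, hz.pos (i + 1),
      hz.pos (i + 2), hz.lt (i + 2)] with t ht h₁ h₂ hlt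
    rw [Pi.pow_apply, Real.norm_of_nonneg (sq_nonneg _), Real.norm_of_nonneg h₁.le] at ht
    nlinarith
  obtain ⟨C, hC⟩ := exists_eventually_le_add_of_deriv_le
    ((hz.hasDerivAt (i + 2)).mono fun t ht => ht.const_mul 2) (hz.hasDerivAt_log i) hderiv
  filter_upwards [hC, (hz.tendsto_atTop (i + 2)).eventually_gt_atTop C, hz.pos i] with t ht hCt h₀
  rw [← Real.lt_log_iff_exp_lt h₀]
  linarith

theorem id_lt (hz : LogDerChain z) (i : ℕ) : ∀ᶠ t in atTop, t < z i t := by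
  obtain ⟨C, hC⟩ := exists_eventually_le_add_of_deriv_le (f := fun t => 2 * t) (f' := fun _ => 2)
    (.of_forall fun t => by simpa using (hasDerivAt_id t).const_mul 2) (hz.hasDerivAt i) <| by
      filter_upwards [(hz.tendsto_atTop i).eventually_ge_atTop 2,
        (hz.tendsto_atTop (i + 1)).eventually_ge_atTop 1] with t h₀ h₁
      nlinarith
  filter_upwards [hC, eventually_gt_atTop C] with t ht hCt
  linarith

theorem exp_iterate_lt (hz : LogDerChain z) (n i : ℕ) :
    ∀ᶠ t in atTop, Real.exp^[n] t < z i t := by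
  induction n generalizing i with
  | zero => exact hz.id_lt i
  | succ n ih =>
    filter_upwards [ih (i + 2), hz.exp_lt i] with t hlt hexp
    rw [Function.iterate_succ_apply']
    exact (Real.exp_lt_exp.2 hlt).trans hexp

theorem exists_log_le_mul_add (hz : LogDerChain z) (i : ℕ) :
    ∃ C, ∀ᶠ t in atTop, Real.log (z i t) ≤ t * z (i + 1) t + C := by
  refine exists_eventually_le_mul_deriv_add (hz.hasDerivAt_log i) (hz.hasDerivAt (i + 1)) ?_
  filter_upwards [hz.pos (i + 1), hz.pos (i + 2)] with t h₁ h₂ using (mul_pos h₁ h₂).le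

end LogDerChain

end LogDerChains

section Domination

open Asymptotics

theorem eventually_sum_ne_zero_of_isLittleO {α ι E : Type*} [NormedAddCommGroup E] {l : Filter α}
    {s : Finset ι} {f : ι → α → E} {i : ι} (hi : i ∈ s)
    (hlittle : ∀ j ∈ s, j ≠ i → f j =o[l] f i) (hne : ∀ᶠ t in l, f i t ≠ 0) :
    ∀ᶠ t in l, ∑ j ∈ s, f j t ≠ 0 := by
  classical
  have hrest : (∑ j ∈ s.erase i, f j) =o[l] f i :=
    .sum fun j hj => hlittle j (Finset.mem_of_mem_erase hj) (Finset.ne_of_mem_erase hj)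
  filter_upwards [hrest.right_isBigO_add.eq_zero_imp, hne] with t himp hft hsum
  exact hft (himp (by rwa [Finset.sum_apply, Finset.sum_erase_add _ _ hi]))

namespace LogDerChain

variable {z : ℕ → ℝ → ℝ}

theorem isBigO (hz : LogDerChain z) {i j : ℕ} (hij : i ≤ j) : z j =O[atTop] z i := by
  induction j, hij using Nat.le_induction with
  | base => exact isBigO_refl ..
  | succ j _ ih =>
    refine IsBigO.trans (.of_bound' ?_) ih
    filter_upwards [hz.pos j, hz.pos (j + 1), hz.lt j] with t h₀ h₁ hlt
    rw [Real.norm_of_nonneg h₀.le, Real.norm_of_nonneg h₁.le]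
    exact hlt.le

theorem one_isBigO (hz : LogDerChain z) (i : ℕ) : (1 : ℝ → ℝ) =O[atTop] z i :=
  (isLittleO_const_left.2 (.inr (tendsto_norm_atTop_atTop.comp (hz.tendsto_atTop i)))).isBigO

end LogDerChain

/-- The monomial `∏ i, z i ^ α i` in the members of a sequence of functions. -/
noncomputable def monomial (z : ℕ → ℝ → ℝ) (α : ℕ →₀ ℕ) : ℝ → ℝ := α.prod fun i n => z i ^ n

theorem monomial_add (z : ℕ → ℝ → ℝ) (α β : ℕ →₀ ℕ) :
    monomial z (α + β) = monomial z α * monomial z β :=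
  Finsupp.prod_add_index' (fun _ => pow_zero _) fun _ => pow_add _

theorem monomial_single_one (z : ℕ → ℝ → ℝ) (i : ℕ) : monomial z (.single i 1) = z i := by
  simp [monomial]

namespace LogDerChain

variable {z : ℕ → ℝ → ℝ}

theorem monomial_pos (hz : LogDerChain z) (α : ℕ →₀ ℕ) : ∀ᶠ t in atTop, 0 < monomial z α t := by
  filter_upwards [(eventually_all_finset α.support).2 fun i _ => hz.pos i] with t ht
  rw [monomial, Finsupp.prod, Finset.prod_apply]
  exact Finset.prod_pos fun i hi => pow_pos (ht i hi) _

theorem one_isBigO_monomial (hz : LogDerChain z) (α : ℕ →₀ ℕ) :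
    (1 : ℝ → ℝ) =O[atTop] monomial z α := by
  refine (IsBigO.finsetProd fun i (_ : i ∈ α.support) => (hz.one_isBigO i).pow (α i)).congr ?_ ?_
  · simp
  · simp [monomial, Finsupp.prod]

theorem monomial_isLittleO_of_forall_le (hz : LogDerChain z) {α : ℕ →₀ ℕ} {i : ℕ}
    (hα : ∀ j ≤ i, α j = 0) : monomial z α =o[atTop] z i := by
  have hfactor : ∀ j ∈ α.support, (z j ^ α j) =O[atTop] (z (i + 1) ^ α j) := fun j hj =>
    (hz.isBigO (not_le.1 fun hji => Finsupp.mem_support_iff.1 hj (hα j hji))).pow _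
  have hbig : monomial z α =O[atTop] (z (i + 1) ^ α.sum fun _ n => n) := by
    refine (IsBigO.finsetProd hfactor).congr ?_ ?_
    · simp [monomial, Finsupp.prod]
    · simp [Finsupp.sum, Finset.prod_pow_eq_pow_sum]
  exact hbig.trans_isLittleO (hz.pow_isLittleO i _)

theorem monomial_isLittleO (hz : LogDerChain z) {α β : ℕ →₀ ℕ} {i : ℕ}
    (heq : ∀ j < i, α j = β j) (hlt : α i < β i) : monomial z α =o[atTop] monomial z β := by
  set μ := α.filter (· ≤ i)
  set τ := α.filter (¬ · ≤ i)
  have hα : α = μ + τ := (Finsupp.filter_add_filter_not ..).symm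
  have hle : μ + .single i 1 ≤ β := fun j => by
    rcases lt_trichotomy j i with hj | rfl | hj
    · simp [μ, hj.le, hj.ne, heq j hj]
    · simpa [μ] using hlt
    · simp [μ, hj.not_ge, hj.ne']
  obtain ⟨ν, hβ⟩ := exists_add_of_le hle
  have hτ : monomial z τ =o[atTop] z i :=
    hz.monomial_isLittleO_of_forall_le fun j hj => Finsupp.filter_apply_neg _ _ (not_not.2 hj)
  rw [hα, hβ]
  simp only [monomial_add, monomial_single_one]
  exact (((isBigO_refl (monomial z μ) atTop).mul_isLittleO hτ).mul_isBigO
    (hz.one_isBigO_monomial ν)).congr_left fun t => mul_one _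

theorem mul_monomial_isLittleO (hz : LogDerChain z) {c : ℝ → ℝ} (hc : ∀ i, c =O[atTop] z i)
    {α β : ℕ →₀ ℕ} (hlt : toLex α < toLex β) : (c * monomial z α) =o[atTop] monomial z β := by
  obtain ⟨i, heq, hi⟩ := Finsupp.Lex.lt_iff.1 hlt
  have hbig : (c * monomial z α) =O[atTop] monomial z (.single (i + 1) 1 + α) := by
    rw [monomial_add, monomial_single_one]
    exact (hc (i + 1)).mul (isBigO_refl ..)
  refine hbig.trans_isLittleO (hz.monomial_isLittleO (i := i) (fun j hj => ?_) ?_)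
  · rw [Finsupp.add_apply, Finsupp.single_eq_of_ne (by lia), zero_add]
    exact heq j hj
  · rw [Finsupp.add_apply, Finsupp.single_eq_of_ne (by lia), zero_add]
    exact hi

end LogDerChain

theorem isBigO_of_forall_ltE {H : Subring RGerm} {f g : ℝ → ℝ}
    (h : ∀ a ∈ H, LtE a g) (hf : (f : RGerm) ∈ H) : f =O[atTop] g := by
  refine .of_bound' ?_
  filter_upwards [ltE_coe.1 (h f hf), ltE_coe.1 (h _ (H.neg_mem hf))] with t hlt hneg
  exact (abs_lt.2 ⟨neg_lt.1 hneg, hlt⟩).le.trans (le_abs_self _)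

theorem coe_monomial (z : ℕ → ℝ → ℝ) (α : ℕ →₀ ℕ) :
    (monomial z α : RGerm) = α.prod fun i n => (z i : RGerm) ^ n :=
  map_finsuppProd (Germ.coeRingHom atTop) ..

theorem aeval_coe_eq_coe_sum (z : ℕ → ℝ → ℝ) {H : Subring RGerm} (p : MvPolynomial ℕ H)
    {c : (ℕ →₀ ℕ) → ℝ → ℝ} (hc : ∀ α, (c α : RGerm) = p.coeff α) :
    MvPolynomial.aeval (fun i => (z i : RGerm)) p =
      ((fun t => ∑ α ∈ p.support, (c α * monomial z α) t : ℝ → ℝ) : RGerm) := by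
  calc MvPolynomial.aeval (fun i => (z i : RGerm)) p
      = ∑ α ∈ p.support, (c α : RGerm) * (monomial z α : RGerm) := by
        simp only [MvPolynomial.aeval_def, MvPolynomial.eval₂_eq, hc, coe_monomial]
        rfl
    _ = ((∑ α ∈ p.support, c α * monomial z α : ℝ → ℝ) : RGerm) :=
        (map_sum (Germ.coeRingHom atTop) ..).symm
    _ = _ := by rw [Finset.sum_fn]

/- The lexicographically largest monomial of `p` dominates all the others, whatever their
coefficients. -/
theorem LogDerChain.isUnit_aeval {z : ℕ → ℝ → ℝ} (hz : LogDerChain z) {H : Subring RGerm}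
    (hH : IsHardyField H) (hzH : ∀ i, ∀ a ∈ H, LtE a (z i)) {p : MvPolynomial ℕ H} (hp : p ≠ 0) :
    IsUnit (MvPolynomial.aeval (fun i => (z i : RGerm)) p) := by
  choose c hc using fun α => exists_coe_eq (p.coeff α : H)
  obtain ⟨β, hβ, hmax⟩ :=
    Finset.exists_max_image p.support toLex (MvPolynomial.support_nonempty.2 hp)
  have hβ₀ : (c β : RGerm) ≠ 0 := by
    rw [hc]
    exact ZeroMemClass.coe_eq_zero.not.2 (MvPolynomial.mem_support_iff.1 hβ)
  have hβH : (c β : RGerm) ∈ H := hc β ▸ (p.coeff β).2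
  have hcβ : ∀ᶠ t in atTop, c β t ≠ 0 := isUnit_coe.1 (hH.isUnit hβH hβ₀)
  rw [aeval_coe_eq_coe_sum z p hc, isUnit_coe]
  refine eventually_sum_ne_zero_of_isLittleO hβ (fun α hα hne => ?_) ?_
  · have hlt : toLex α < toLex β := (hmax α hα).lt_of_ne (toLex_inj.not.2 hne)
    have hquot : ((c α * (c β)⁻¹ : ℝ → ℝ) : RGerm) ∈ H :=
      H.mul_mem (hc α ▸ (p.coeff α).2) (hH.inv_mem hβH hβ₀)
    have hlittle := (isBigO_refl (c β) atTop).mul_isLittleO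
      (hz.mul_monomial_isLittleO (fun i => isBigO_of_forall_ltE (hzH i) hquot) hlt)
    refine hlittle.congr' ?_ .rfl
    filter_upwards [hcβ] with t ht
    simp only [Pi.mul_apply, Pi.inv_apply]
    field_simp
  · filter_upwards [hcβ, hz.monomial_pos β] with t h₁ h₂ using mul_ne_zero h₁ h₂.ne'

theorem IsOverhardian.isHardianOver {H : Subring RGerm} {y : RGerm} (hy : IsOverhardian y)
    (hH : IsHardyField H) (hyH : ∀ i, ∀ a ∈ H, LtE a (iterLogDer y i)) : IsHardianOver H y := by
  obtain ⟨z, hz, hzy⟩ := hy.exists_logDerChain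
  have hunit : ∀ a ∈ Algebra.adjoin H (Set.range (iterLogDer y)), a ≠ 0 → IsUnit a := by
    intro a ha h₀
    rw [Algebra.adjoin_range_eq_range_aeval] at ha
    obtain ⟨p, rfl⟩ := ha
    have hp : p ≠ 0 := by
      rintro rfl
      exact h₀ (map_zero _)
    exact (funext hzy : _ = iterLogDer y) ▸
      hz.isUnit_aeval hH (fun i a ha => (hzy i).symm ▸ hyH i a ha) hp
  obtain ⟨K, hK, hHK, hyK⟩ := hH.exists_adjoin
    (Set.range_subset_iff.2 fun i => (hy.isSmoothUnit i).1) (Set.forall_mem_range.2 fun i => by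
      rw [der_eq_mul_logDer (hy.isUnit i)]
      exact mul_mem (Algebra.subset_adjoin ⟨i, rfl⟩) (Algebra.subset_adjoin ⟨i + 1, rfl⟩)) hunit
  exact ⟨K, hK, hHK, hyK ⟨0, rfl⟩⟩

end Domination

section ExpDomination

variable {f f' f'' : ℝ → ℝ} {F H : Subring RGerm} {a b c y : RGerm}

theorem LtE.trans (hab : LtE a b) (hbc : LtE b c) : LtE a c := by
  obtain ⟨f, rfl⟩ := exists_coe_eq a
  obtain ⟨g, rfl⟩ := exists_coe_eq b
  obtain ⟨h, rfl⟩ := exists_coe_eq c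
  filter_upwards [ltE_coe.1 hab, ltE_coe.1 hbc] with t h₁ h₂ using h₁.trans h₂

theorem LtE.isUnit (ha : LtE 0 a) : IsUnit a := by
  obtain ⟨f, rfl⟩ := exists_coe_eq a
  exact isUnit_coe.2 ((ltE_coe.1 ha).mono fun t ht => ht.ne')

theorem le_exp_iterate (n : ℕ) (t : ℝ) : t ≤ Real.exp^[n] t :=
  Function.id_le_iterate_of_id_le (fun s => (Real.add_one_le_exp s).trans' (by simp)) n t

theorem eventually_mul_exp_iterate_add_le (n : ℕ) (C : ℝ) :
    ∀ᶠ t in atTop, t * Real.exp^[n] t + C ≤ Real.exp^[n + 1] t := by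
  have htendsto : Tendsto Real.exp^[n] atTop atTop :=
    tendsto_atTop_mono (le_exp_iterate n) tendsto_id
  have hsq : ∀ᶠ u in atTop, 2 * u ^ 2 ≤ Real.exp u := by
    filter_upwards [(Real.tendsto_exp_div_pow_atTop 2).eventually_ge_atTop 2, eventually_gt_atTop 0]
      with u hu h₀ using (le_div_iff₀ (by positivity)).1 hu
  filter_upwards [htendsto.eventually
    (hsq.and ((eventually_ge_atTop 1).and (eventually_ge_atTop C)))] with t ⟨hexp, h₁, hC⟩
  rw [Function.iterate_succ_apply']
  nlinarith [le_exp_iterate n t]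

theorem not_eventually_deriv_le_const (hf : ∀ᶠ t in atTop, HasDerivAt f (f' t) t)
    (hexp : ∀ᶠ t in atTop, Real.exp t < f t) (C : ℝ) : ¬ ∀ᶠ t in atTop, f' t ≤ C := by
  intro h
  obtain ⟨D, hD⟩ := exists_eventually_le_add_of_deriv_le hf
    (.of_forall fun t => by simpa using (hasDerivAt_id t).const_mul C) h
  obtain ⟨t, hle, hlt, hmul, hC, h₀⟩ := (hD.and (hexp.and
    ((eventually_mul_exp_iterate_add_le 0 D).and
      ((eventually_ge_atTop C).and (eventually_ge_atTop 0))))).exists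
  simp only [Function.iterate_zero_apply, zero_add, Function.iterate_one] at hle hmul
  nlinarith

theorem eventually_exp_iterate_lt_deriv (hf : ∀ᶠ t in atTop, HasDerivAt f (f' t) t)
    (hf' : ∀ᶠ t in atTop, HasDerivAt f' (f'' t) t)
    (hsign : (∀ᶠ t in atTop, 0 ≤ f'' t) ∨ ∀ᶠ t in atTop, f'' t ≤ 0)
    (hexp : ∀ n : ℕ, ∀ᶠ t in atTop, Real.exp^[n] t < f t) (n : ℕ) :
    ∀ᶠ t in atTop, Real.exp^[n] t < f' t := by
  rcases hsign with hconvex | hconcave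
  · obtain ⟨C, hC⟩ := exists_eventually_le_mul_deriv_add hf hf' hconvex
    filter_upwards [hC, hexp (n + 1), eventually_mul_exp_iterate_add_le n C, eventually_gt_atTop 0]
      with t hle hlt hmul h₀
    exact lt_of_mul_lt_mul_left (by linarith) h₀.le
  · obtain ⟨C, hC⟩ := exists_eventually_le_add_of_deriv_le hf'
      (.of_forall fun t => hasDerivAt_const t (0 : ℝ)) hconcave
    exact absurd (by simpa using hC) (not_eventually_deriv_le_const hf (hexp 1) C)

theorem logGerm_mem_smoothGerms (ha : a ∈ smoothGerms) (hpos : LtE 0 a) :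
    logGerm a ∈ smoothGerms := by
  obtain ⟨f, rfl⟩ := exists_coe_eq a
  refine coe_mem_smoothGerms.2 fun r => ?_
  filter_upwards [coe_mem_smoothGerms.1 ha r, ltE_coe.1 hpos] with t ht h₀ using ht.log h₀.ne'

theorem der_logGerm (ha : a ∈ smoothGerms) (hpos : LtE 0 a) : der (logGerm a) = logDer a := by
  have hlog := logGerm_mem_smoothGerms ha hpos
  obtain ⟨f, rfl⟩ := exists_coe_eq a
  refine (der_coe_eq_coe_iff hlog).2 ?_
  filter_upwards [eventually_hasDerivAt ha, ltE_coe.1 hpos] with t ht h₀ using ht.log h₀.ne'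

theorem expIter_ltE_logGerm {n : ℕ} (hpos : LtE 0 a) (h : LtE (expIter (n + 1)) a) :
    LtE (expIter n) (logGerm a) := by
  obtain ⟨f, rfl⟩ := exists_coe_eq a
  filter_upwards [ltE_coe.1 h, ltE_coe.1 hpos] with t ht h₀
  rw [Function.iterate_succ_apply'] at ht
  exact (Real.lt_log_iff_exp_lt h₀).2 ht

theorem ltE_zero_of_expIter_ltE {n : ℕ} (h : LtE (expIter n) a) : LtE 0 a := by
  refine LtE.trans (ltE_coe.2 ?_) h
  filter_upwards [eventually_gt_atTop 0] with t ht using ht.trans_le (le_exp_iterate n t)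

namespace IsHardyField

theorem expIter_ltE_logDer (hF : IsHardyField F) (ha : a ∈ F) (h : ∀ n, LtE (expIter n) a)
    (n : ℕ) : LtE (expIter n) (logDer a) := by
  have hpos := ltE_zero_of_expIter_ltE (h 0)
  have hsmooth := hF.subset_smooth a ha
  have hq : logDer a ∈ F := hF.logDer_mem ha hpos.isUnit.ne_zero
  obtain ⟨f, hf⟩ := exists_coe_eq (logGerm a)
  obtain ⟨q, hqf⟩ := exists_coe_eq (logDer a)
  have hderiv : ∀ᶠ t in atTop, HasDerivAt f (q t) t :=
    (der_coe_eq_coe_iff (hf ▸ logGerm_mem_smoothGerms hsmooth hpos)).1 <| by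
      rw [hf, hqf, der_logGerm hsmooth hpos]
  have hsign : (∀ᶠ t in atTop, 0 ≤ deriv q t) ∨ ∀ᶠ t in atTop, deriv q t ≤ 0 := by
    have hq' : (deriv q : RGerm) ∈ F := (hqf ▸ hF.der_mem _ hq : der (q : RGerm) ∈ F)
    rcases hF.ltE_trichotomy F.zero_mem hq' with hlt | heq | hlt
    · exact .inl ((ltE_coe.1 hlt).mono fun t => le_of_lt)
    · exact .inl ((Germ.coe_eq.1 heq).mono fun t => le_of_eq)
    · exact .inr ((ltE_coe.1 hlt).mono fun t => le_of_lt)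
  rw [← hqf]
  exact eventually_exp_iterate_lt_deriv hderiv
    (eventually_hasDerivAt (hqf ▸ hF.subset_smooth _ hq)) hsign
    (fun n => ltE_coe.1 (hf ▸ expIter_ltE_logGerm hpos (h (n + 1)))) n

theorem logDer_ltE (hF : IsHardyField F) (ha : a ∈ F) (hpos : LtE 0 a) : LtE (logDer a) a := by
  have hq : logDer a ∈ F := hF.logDer_mem ha hpos.isUnit.ne_zero
  have hsmooth := hF.subset_smooth a ha
  obtain ⟨f, rfl⟩ := exists_coe_eq a
  by_contra hlt
  have hle : ∀ᶠ t in atTop, f t ≤ deriv f t / f t := by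
    rcases (hF.ltE_trichotomy hq ha).resolve_left hlt with heq | hgt
    · exact (Germ.coe_eq.1 heq).mono fun t => ge_of_eq
    · exact (ltE_coe.1 hgt).mono fun t => le_of_lt
  refine not_eventually_sq_le_deriv (eventually_hasDerivAt hsmooth) (ltE_coe.1 hpos) ?_
  filter_upwards [hle, ltE_coe.1 hpos] with t ht h₀
  rwa [sq, ← le_div_iff₀ h₀]

theorem isOverhardian (hF : IsHardyField F) (ha : a ∈ F) (h : ∀ n, LtE (expIter n) a) :
    IsOverhardian a := by
  have hmem : ∀ i, iterLogDer a i ∈ F ∧ ∀ n, LtE (expIter n) (iterLogDer a i) := fun i => by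
    induction i with
    | zero => exact ⟨ha, h⟩
    | succ i ih =>
      exact ⟨hF.logDer_mem ih.1 (ltE_zero_of_expIter_ltE (ih.2 0)).isUnit.ne_zero,
        hF.expIter_ltE_logDer ih.1 ih.2⟩
  have hpos : ∀ i, LtE 0 (iterLogDer a i) := fun i => ltE_zero_of_expIter_ltE ((hmem i).2 0)
  have hdefined : ∀ i, LogDerDefined a i := fun i => by
    induction i with
    | zero => exact hF.subset_smooth a ha
    | succ i ih =>
      have hinv := hF.inv_mem (hmem i).1 (hpos i).isUnit.ne_zero
      exact ⟨ih, hF.subset_smooth _ (hmem i).1, _, hF.subset_smooth _ hinv,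
        (hpos i).isUnit.mul_inv_cancel⟩
  exact ⟨hF.subset_smooth a ha, fun i => ⟨hdefined i, hpos i, hF.logDer_ltE (hmem i).1 (hpos i)⟩⟩

end IsHardyField

end ExpDomination

section Overhardian

variable {H : Subring RGerm} {a y : RGerm}

/-- The Hardy field of germs of constant functions. -/
noncomputable def constGerms : Subring RGerm :=
  ((Germ.coeRingHom atTop).comp (Pi.constRingHom ℝ ℝ)).range

theorem mem_constGerms : a ∈ constGerms ↔ ∃ c : ℝ, Germ.const c = a := Iff.rfl

theorem isHardyField_constGerms : IsHardyField constGerms := by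
  refine ⟨fun a ha => ?_, isField_iff.2 fun a ha h₀ => ?_, fun a ha => ?_⟩ <;>
    obtain ⟨c, rfl⟩ := mem_constGerms.1 ha
  · exact coe_mem_smoothGerms.2 fun r => .of_forall fun t => contDiffAt_const
  · refine ⟨isUnit_coe.2 (.of_forall fun _ hc => h₀ ?_), mem_constGerms.2 ⟨c⁻¹, rfl⟩⟩
    exact congrArg Germ.const hc
  · exact der_const c ▸ constGerms.zero_mem

namespace IsOverhardian

theorem expIter_ltE (hy : IsOverhardian y) (n : ℕ) : LtE (expIter n) y := by
  obtain ⟨z, hz, hzy⟩ := hy.exists_logDerChain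
  rw [← show (z 0 : RGerm) = y from hzy 0]
  exact ltE_coe.2 (hz.exp_iterate_lt n 0)

theorem isHardianOver_constGerms (hy : IsOverhardian y) : IsHardianOver constGerms y := by
  refine hy.isHardianOver isHardyField_constGerms fun i a ha => ?_
  obtain ⟨c, rfl⟩ := mem_constGerms.1 ha
  obtain ⟨z, hz, hzy⟩ := hy.exists_logDerChain
  exact hzy i ▸ ltE_coe.2 ((hz.tendsto_atTop i).eventually_gt_atTop c)

theorem logGerm (hy : IsOverhardian y) : IsOverhardian (logGerm y) := by
  obtain ⟨F, hF, -, hyF⟩ := hy.isHardianOver_constGerms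
  have hpos : LtE 0 y := (hy.2 0).2.1
  have hder : der (HardyGerm.logGerm y) ∈ F :=
    der_logGerm hy.1 hpos ▸ hF.logDer_mem hyF hpos.isUnit.ne_zero
  obtain ⟨K, hK, -, hlog⟩ :=
    hF.isHardianOver_of_der_mem (logGerm_mem_smoothGerms hy.1 hpos) hder
  exact hK.isOverhardian hlog fun n => expIter_ltE_logGerm hpos (hy.expIter_ltE (n + 1))

end IsOverhardian

theorem IsHardianOver.isHardian (hy : IsHardianOver H y) : IsHardian y :=
  let ⟨_, hF, _, hyF⟩ := hy
  hF.isHardian hyF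

theorem IsHardian.isOverhardian (hy : IsHardian y) (h : ∀ n, LtE (expIter n) y) :
    IsOverhardian y :=
  let ⟨_, _, ⟨hF, hyF⟩, _⟩ := hy
  hF.isOverhardian hyF h

theorem isOverhardian_iff : IsOverhardian y ↔ IsHardian y ∧ ∀ n, LtE (expIter n) y :=
  ⟨fun hy => ⟨hy.isHardianOver_constGerms.isHardian, hy.expIter_ltE⟩,
    fun hy => hy.1.isOverhardian hy.2⟩

end Overhardian

section ExpCofinal

variable {H : Subring RGerm} {a y : RGerm}

/-- `H` is cofinally closed under exponentiation: some element of `H` exceeds `x`, and for every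
`a ∈ H` some element of `H` exceeds `e ^ a`. Liouville closed Hardy fields have this property. -/
structure IsExpCofinal (H : Subring RGerm) : Prop where
  exists_id_ltE : ∃ b ∈ H, LtE (expIter 0) b
  exists_exp_ltE : ∀ a ∈ H, ∃ b ∈ H, LtE (a.map Real.exp) b

namespace IsExpCofinal

theorem exists_expIter_ltE (hH : IsExpCofinal H) (n : ℕ) : ∃ b ∈ H, LtE (expIter n) b := by
  induction n with
  | zero => exact hH.exists_id_ltE
  | succ n ih =>
    obtain ⟨a, ha, hlt⟩ := ih
    obtain ⟨b, hb, hexp⟩ := hH.exists_exp_ltE a ha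
    refine ⟨b, hb, LtE.trans ?_ hexp⟩
    obtain ⟨f, rfl⟩ := exists_coe_eq a
    filter_upwards [ltE_coe.1 hlt] with t ht
    rw [Function.iterate_succ_apply']
    exact Real.exp_lt_exp.2 ht

theorem exists_exp_mul_ltE (hH : IsExpCofinal H) {f : ℝ → ℝ} (hf : (f : RGerm) ∈ H) :
    ∃ b ∈ H, LtE ((fun t => Real.exp (t * f t) : ℝ → ℝ) : RGerm) b := by
  obtain ⟨k, hk, hlt⟩ := hH.exists_id_ltE
  obtain ⟨g, rfl⟩ := exists_coe_eq k
  obtain ⟨b, hb, hexp⟩ := hH.exists_exp_ltE _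
    (H.mul_mem hk (H.add_mem (H.mul_mem hf hf) H.one_mem))
  refine ⟨b, hb, LtE.trans (ltE_coe.2 ?_) hexp⟩
  filter_upwards [ltE_coe.1 hlt, eventually_gt_atTop 0] with t ht h₀
  refine Real.exp_lt_exp.2 ?_
  change t < g t at ht
  change t * f t < g t * (f t * f t + 1)
  nlinarith [sq_nonneg (f t - 1), sq_nonneg (f t)]

theorem ltE_iterLogDer (hH : IsExpCofinal H) (hy : IsOverhardian y) (h : ∀ a ∈ H, LtE a y)
    (i : ℕ) : ∀ a ∈ H, LtE a (iterLogDer y i) := by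
  obtain ⟨z, hz, hzy⟩ := hy.exists_logDerChain
  induction i with
  | zero => exact h
  | succ i ih =>
    intro a ha
    obtain ⟨f, rfl⟩ := exists_coe_eq a
    obtain ⟨C, hC⟩ := hz.exists_log_le_mul_add i
    obtain ⟨b, hb, hexp⟩ := hH.exists_exp_mul_ltE (f := f + 1) (H.add_mem ha H.one_mem)
    rw [← hzy] at ih ⊢
    filter_upwards [hC, ltE_coe.1 (hexp.trans (ih b hb)), hz.pos i, eventually_gt_atTop 0,
      eventually_ge_atTop C] with t hle hlt hpos h₀ hCt
    have hlog : t * (f t + 1) < Real.log (z i t) := (Real.lt_log_iff_exp_lt hpos).2 hlt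
    exact lt_of_mul_lt_mul_left (by linarith : t * f t < t * z (i + 1) t) h₀.le

theorem tfae (hH : IsExpCofinal H) (hField : IsHardyField H) (h : ∀ a ∈ H, LtE a y) :
    List.TFAE [IsOverhardian y, IsHardianOver H y, IsHardian y] := by
  tfae_have 1 → 2 := fun hy => hy.isHardianOver hField (hH.ltE_iterLogDer hy h)
  tfae_have 2 → 3 := fun hy => hy.isHardian
  tfae_have 3 → 1 := fun hy => hy.isOverhardian fun n =>
    let ⟨b, hb, hlt⟩ := hH.exists_expIter_ltE n
    hlt.trans (h b hb)
  tfae_finish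

end IsExpCofinal

theorem exists_const_mul_exp_of_der_eq_mul {f g : ℝ → ℝ}
    (hf : (f : RGerm) ∈ smoothGerms) (hg : (g : RGerm) ∈ smoothGerms)
    (hder : der (g : RGerm) = der f * g) :
    ∃ c : ℝ, ∀ᶠ t in atTop, g t = c * Real.exp (f t) := by
  have hquot : ((fun t => g t * Real.exp (-f t) : ℝ → ℝ) : RGerm) ∈ smoothGerms := by
    refine coe_mem_smoothGerms.2 fun r => ?_
    filter_upwards [coe_mem_smoothGerms.1 hf r, coe_mem_smoothGerms.1 hg r] with t h₁ h₂
    exact h₂.mul h₁.neg.exp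
  have hzero : der ((fun t => g t * Real.exp (-f t) : ℝ → ℝ) : RGerm) = 0 := by
    refine (der_coe_eq_coe_iff (g := 0) hquot).2 ?_
    filter_upwards [eventually_hasDerivAt hf, (der_coe_eq_coe_iff (g := deriv f * g) hg).1 hder]
      with t h₁ h₂
    refine (h₂.mul h₁.fun_neg.exp).congr_deriv ?_
    simp only [Pi.mul_apply, Pi.zero_apply]
    ring
  obtain ⟨c, hc⟩ := exists_eq_const_of_der_eq_zero hquot hzero
  refine ⟨c, (Germ.coe_eq.1 hc).mono fun t ht => ?_⟩
  rw [← show _ = c from ht, mul_assoc, ← Real.exp_add, neg_add_cancel, Real.exp_zero, mul_one]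

namespace IsLiouvilleClosedHardyField

theorem exists_id_ltE (hH : IsLiouvilleClosedHardyField H) : ∃ b ∈ H, LtE (expIter 0) b := by
  obtain ⟨a, ha, hder⟩ := hH.exists_integral 1 H.one_mem
  obtain ⟨f, rfl⟩ := exists_coe_eq a
  have hf : ∀ᶠ t in atTop, HasDerivAt f 1 t :=
    (der_coe_eq_coe_iff (g := 1) (hH.isHardyField.subset_smooth _ ha)).1 hder
  refine ⟨_, H.add_mem ha ha, ltE_coe.2 ?_⟩
  obtain ⟨C, hC⟩ := exists_eventually_le_add_of_deriv_le (.of_forall hasDerivAt_id) hf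
    (.of_forall fun _ => le_rfl)
  filter_upwards [hC, eventually_gt_atTop (2 * C)] with t ht hCt
  change t ≤ f t + C at ht
  change t < f t + f t
  linarith

/- A solution `w` of `w' = a' w` is `c • e ^ a` with `c ≠ 0` perhaps not in `H`, but then
`e ^ a < n * w ^ 2 + 1` as soon as `1 < n * c ^ 2`. -/
theorem exists_exp_ltE (hH : IsLiouvilleClosedHardyField H) (ha : a ∈ H) :
    ∃ b ∈ H, LtE (a.map Real.exp) b := by
  obtain ⟨w, hw, hw₀, hder⟩ := hH.exists_exp_integral _ (hH.isHardyField.der_mem a ha)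
  obtain ⟨f, rfl⟩ := exists_coe_eq a
  obtain ⟨g, rfl⟩ := exists_coe_eq w
  obtain ⟨c, hc⟩ := exists_const_mul_exp_of_der_eq_mul (hH.isHardyField.subset_smooth _ ha)
    (hH.isHardyField.subset_smooth _ hw) hder
  have hc₀ : c ≠ 0 := by
    rintro rfl
    exact hw₀ (Germ.coe_eq.2 (hc.mono fun t ht => by simp [ht]))
  obtain ⟨n, hn⟩ := exists_nat_gt (c ^ 2)⁻¹
  replace hn : 1 < n * c ^ 2 := (inv_lt_iff_one_lt_mul₀ (by positivity)).1 hn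
  refine ⟨_, H.add_mem (H.mul_mem (natCast_mem H n) (H.mul_mem hw hw)) H.one_mem, ltE_coe.2 ?_⟩
  filter_upwards [hc] with t ht
  change Real.exp (f t) < n * (g t * g t) + 1
  rw [ht]
  nlinarith [sq_nonneg (Real.exp (f t) - 1), sq_nonneg (Real.exp (f t))]

theorem isExpCofinal (hH : IsLiouvilleClosedHardyField H) : IsExpCofinal H :=
  ⟨hH.exists_id_ltE, fun _ => hH.exists_exp_ltE⟩

end IsLiouvilleClosedHardyField

end ExpCofinal

end HardyGerm

theorem mainTheorem9_general :
    (∀ H : Subring HardyGerm.RGerm, HardyGerm.IsHardyField H → HardyGerm.IsExpCofinal H →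
      ∀ y : HardyGerm.RGerm, (∀ h ∈ H, HardyGerm.LtE h y) →
        List.TFAE [HardyGerm.IsOverhardian y, HardyGerm.IsHardianOver H y,
          HardyGerm.IsHardian y]) ∧
    (∀ y : HardyGerm.RGerm, HardyGerm.IsOverhardian y →
      HardyGerm.IsOverhardian (HardyGerm.logGerm y)) ∧
    (∀ y : HardyGerm.RGerm, HardyGerm.IsOverhardian y ↔
      HardyGerm.IsHardian y ∧ ∀ n : ℕ, HardyGerm.LtE (HardyGerm.expIter n) y) :=
  ⟨fun _ hH hexp _ hy => hexp.tfae hH hy, fun _ hy => hy.logGerm,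
    fun _ => HardyGerm.isOverhardian_iff⟩

theorem mainTheorem9 :
    (∀ H : Subring HardyGerm.RGerm, HardyGerm.IsLiouvilleClosedHardyField H →
      HardyGerm.ContainsReals H →
      ∀ y ∈ HardyGerm.contGerms, (∀ h ∈ H, HardyGerm.LtE h y) →
        List.TFAE [HardyGerm.IsOverhardian y, HardyGerm.IsHardianOver H y,
          HardyGerm.IsHardian y]) ∧
    (∀ y : HardyGerm.RGerm, HardyGerm.IsOverhardian y →
      HardyGerm.IsOverhardian (HardyGerm.logGerm y)) ∧
    (∀ y ∈ HardyGerm.contGerms,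
      (HardyGerm.IsOverhardian y ↔
        HardyGerm.IsHardian y ∧ ∀ n : ℕ, HardyGerm.LtE (HardyGerm.expIter n) y)) :=
  ⟨fun _ hH _ _ _ hy =>
      mainTheorem9_general.1 _ hH.isHardyField hH.isExpCofinal _ hy,
    mainTheorem9_general.2.1, fun y _ => mainTheorem9_general.2.2 y⟩
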